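/- Let $n\ge 2$ and let $H^n=\{(x,t)\in\mathbb R^n\times\mathbb R : t\ge 1,\ t^2-\langle x,x\rangle=1\}$ be hyperbolic $n$-space (hyperboloid model) with its geodesic distance $d$, given by $\cosh d\big((x,t),(y,s)\big)=ts-\langle x,y\rangle$; write $B(z,\varrho)=\{x\in H^n: d(x,z)\le \varrho\}$. A set $K\subseteq H^n$ is called complete if $\operatorname{diam}(K\cup\{y\})>\operatorname{diam}(K)$ for every $y\in H^n\setminus K$. For $K\subseteq H^n$ let $$R(K)=\min\{R\ge 0: K\subseteq B(z,R)\text{ for some }z\in H^n\},\qquad r(K)=\max\{r\ge 0: B(z,r)\subseteq K\text{ for some }z\in H^n\}$$ be its circumradius and inradius, whenever this minimum, respectively maximum, exists. For $D>0$ let $\Delta(D)$ be a regular $n$-simplex of edge length $D$ in $H^n$, that is, the (geodesically) convex hull of $n+1$ points whose pairwise distances are all equal to $D$. Let $D>0$ and let $K\subset H^n$ be a complete set of diameter $D$. Then the minima defining $R(K)$ and $R(\Delta(D))$ and the maximum defining $r(K)$ exist, and $$R(K)\le R(\Delta(D))\qquad\text{and}\qquad r(K)\ge D-R(\Delta(D)).$$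 Moreover, $R(K)=R(\Delta(D))$ if and only if $K$ contains a congruent copy of $\Delta(D)$ (the image of $\Delta(D)$ under an isometry of $H^n$), and likewise $r(K)=D-R(\Delta(D))$ if and only if $K$ contains a congruent copy of $\Delta(D)$. -/

import Mathlib

/-- The ambient space `ℝⁿ⁺¹ = e^⊥ ⊕ ℝ e` of the hyperboloid model; only its vector space
structure is used, the geometry comes from `lorentzForm`. -/
abbrev LorentzSpace (n : ℕ) : Type := EuclideanSpace ℝ (Fin n) × ℝ

/-- The bilinear form `𝓑(x₀ + t e, y₀ + s e) = t s - ⟨x₀, y₀⟩`. -/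
noncomputable def lorentzForm {n : ℕ} (p q : LorentzSpace n) : ℝ :=
  p.2 * q.2 - inner ℝ p.1 q.1

/-- Hyperbolic `n`-space `Hⁿ` in the hyperboloid model. -/
@[ext]
structure HypSpace (n : ℕ) where
  /-- the underlying point of `ℝⁿ⁺¹` -/
  pt : LorentzSpace n
  one_le : 1 ≤ pt.2
  form_self : lorentzForm pt pt = 1

namespace HypSpace

theorem lorentz_comm {n : ℕ} (p q : LorentzSpace n) : lorentzForm p q = lorentzForm q p := by
  simp [lorentzForm, real_inner_comm, mul_comm]

theorem lorentz_add_left {n : ℕ} (p q r : LorentzSpace n) :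
    lorentzForm (p + q) r = lorentzForm p r + lorentzForm q r := by
  simp [lorentzForm, inner_add_left]; ring

theorem lorentz_smul_left {n : ℕ} (a : ℝ) (p r : LorentzSpace n) :
    lorentzForm (a • p) r = a * lorentzForm p r := by
  simp [lorentzForm, inner_smul_left]; ring

theorem lorentz_add_right {n : ℕ} (p q r : LorentzSpace n) :
    lorentzForm p (q + r) = lorentzForm p q + lorentzForm p r := by
  rw [lorentz_comm, lorentz_add_left, lorentz_comm q, lorentz_comm r]

theorem lorentz_smul_right {n : ℕ} (a : ℝ) (p r : LorentzSpace n) :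
    lorentzForm p (a • r) = a * lorentzForm p r := by
  rw [lorentz_comm, lorentz_smul_left, lorentz_comm]

theorem normSq_eq {n : ℕ} (x : HypSpace n) : ‖x.pt.1‖ ^ 2 = x.pt.2 ^ 2 - 1 := by
  have := x.form_self
  simp only [lorentzForm, real_inner_self_eq_norm_sq] at this
  linarith

theorem one_le_lorentz {n : ℕ} (x y : HypSpace n) : 1 ≤ lorentzForm x.pt y.pt := by
  have h1 := normSq_eq x
  have h2 := normSq_eq y
  have h3 := real_inner_le_norm x.pt.1 y.pt.1
  have hx := x.one_le
  have hy := y.one_le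
  have h4 : ‖x.pt.1‖ * ‖y.pt.1‖ ≤ x.pt.2 * y.pt.2 - 1 := by
    apply abs_le_of_sq_le_sq' _ _ |>.2
    · rw [mul_pow, h1, h2]; nlinarith [sq_nonneg (x.pt.2 - y.pt.2)]
    · nlinarith
  unfold lorentzForm
  linarith

/-- The form is negative semidefinite on tangent spaces. -/
theorem lorentz_tangent {n : ℕ} (y : HypSpace n) (w : LorentzSpace n)
    (h : lorentzForm w y.pt = 0) : lorentzForm w w ≤ 0 := by
  have h2 := normSq_eq y
  have hy := y.one_le
  have h3 := abs_real_inner_le_norm w.1 y.pt.1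
  have h4 : w.2 * y.pt.2 = inner ℝ w.1 y.pt.1 := by
    unfold lorentzForm at h; linarith
  rw [← h4] at h3
  have h5 : (w.2 * y.pt.2) ^ 2 ≤ ‖w.1‖ ^ 2 * (y.pt.2 ^ 2 - 1) := by
    rw [← h2, ← mul_pow, ← sq_abs]
    gcongr
  unfold lorentzForm
  rw [real_inner_self_eq_norm_sq]
  have h6 : 0 ≤ ‖w.1‖ ^ 2 := sq_nonneg _
  by_contra hc
  nlinarith

theorem lorentz_le {n : ℕ} (x y z : HypSpace n) :
    lorentzForm x.pt z.pt ≤ lorentzForm x.pt y.pt * lorentzForm y.pt z.pt +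
      √(lorentzForm x.pt y.pt ^ 2 - 1) * √(lorentzForm y.pt z.pt ^ 2 - 1) := by
  set a := lorentzForm x.pt y.pt with ha
  set b := lorentzForm y.pt z.pt with hb
  set c := lorentzForm x.pt z.pt with hc
  have ha1 : 1 ≤ a := one_le_lorentz x y
  have hb1 : 1 ≤ b := one_le_lorentz y z
  have key : ∀ s : ℝ, 0 ≤ (b ^ 2 - 1) * (s * s) + (2 * (a * b - c)) * s + (a ^ 2 - 1) := by
    intro s
    have := lorentz_tangent y ((x.pt + (-a) • y.pt) + s • (z.pt + (-b) • y.pt)) (by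
      simp only [lorentz_add_left, lorentz_smul_left, y.form_self, lorentz_comm z.pt y.pt,
        ← ha, ← hb]
      ring)
    simp only [lorentz_add_left, lorentz_smul_left, lorentz_add_right, lorentz_smul_right,
      x.form_self, y.form_self, z.form_self, lorentz_comm z.pt y.pt, lorentz_comm y.pt x.pt,
      lorentz_comm z.pt x.pt, ← ha, ← hb, ← hc] at this
    linarith
  have hd := discrim_le_zero key
  unfold discrim at hd
  have h1 : (c - a * b) ^ 2 ≤ (a ^ 2 - 1) * (b ^ 2 - 1) := by nlinarith
  rw [← Real.sqrt_mul (by nlinarith)]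
  have := Real.le_sqrt_of_sq_le h1
  linarith

/-- `Hⁿ` with its geodesic distance: `cosh d(x, y) = 𝓑(x, y)`. -/
noncomputable instance instMetricSpace (n : ℕ) : MetricSpace (HypSpace n) where
  dist x y := Real.arcosh (lorentzForm x.pt y.pt)
  dist_self x := by simp [x.form_self]
  dist_comm x y := by simp only [lorentz_comm x.pt]
  dist_triangle x y z := by
    have hxy := one_le_lorentz x y
    have hyz := one_le_lorentz y z
    have hxz := one_le_lorentz x z
    have h0 : 0 ≤ Real.arcosh (lorentzForm x.pt y.pt) + Real.arcosh (lorentzForm y.pt z.pt) :=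
      add_nonneg (Real.arcosh_nonneg hxy) (Real.arcosh_nonneg hyz)
    rw [← Real.arcosh_cosh h0, Real.arcosh_le_arcosh (by linarith) (Real.cosh_pos _),
      Real.cosh_add, Real.cosh_arcosh hxy, Real.cosh_arcosh hyz, Real.sinh_arcosh hxy,
      Real.sinh_arcosh hyz]
    exact lorentz_le x y z
  eq_of_dist_eq_zero {x y} h := by
    have h1 : lorentzForm x.pt y.pt = 1 := (Real.arcosh_eq_zero_iff (one_le_lorentz x y)).1 h
    have hx := normSq_eq x
    have hy := normSq_eq y
    have hx1 := x.one_le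
    have hy1 := y.one_le
    have h2 : x.pt.2 * y.pt.2 - 1 = inner ℝ x.pt.1 y.pt.1 := by
      unfold lorentzForm at h1; linarith
    have h3 : (x.pt.2 * y.pt.2 - 1) ^ 2 ≤ (x.pt.2 ^ 2 - 1) * (y.pt.2 ^ 2 - 1) := by
      rw [h2, ← hx, ← hy, ← mul_pow, ← sq_abs]
      exact pow_le_pow_left₀ (abs_nonneg _) (abs_real_inner_le_norm _ _) 2
    have h4 : x.pt.2 = y.pt.2 := by nlinarith [sq_nonneg (x.pt.2 - y.pt.2)]
    have h5 : ‖x.pt.1 - y.pt.1‖ ^ 2 = 0 := by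
      rw [norm_sub_sq_real, hx, hy, ← h2, h4]; ring
    have h6 : x.pt.1 = y.pt.1 := by
      rw [← sub_eq_zero, ← norm_eq_zero]; exact pow_eq_zero_iff (two_ne_zero) |>.1 h5
    exact HypSpace.ext (Prod.ext h6 h4)

/-- The geodesic segment `[x, y]`: the points `cosh s · x + sinh s · u`, `0 ≤ s ≤ T`, where `u` is a
unit tangent vector at `x` with `y = cosh T · x + sinh T · u`. -/
def geodSegment {n : ℕ} (x y : HypSpace n) : Set (HypSpace n) :=
  {z | ∃ u : LorentzSpace n, lorentzForm u x.pt = 0 ∧ -lorentzForm u u = 1 ∧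
    ∃ T s : ℝ, 0 ≤ s ∧ s ≤ T ∧
      y.pt = Real.cosh T • x.pt + Real.sinh T • u ∧
      z.pt = Real.cosh s • x.pt + Real.sinh s • u}

/-- Geodesic convexity. -/
def IsGeodConvex {n : ℕ} (X : Set (HypSpace n)) : Prop :=
  ∀ x ∈ X, ∀ y ∈ X, geodSegment x y ⊆ X

/-- The convex hull `[S]` in `Hⁿ`: the smallest convex set containing `S`. -/
def geodHull {n : ℕ} (S : Set (HypSpace n)) : Set (HypSpace n) :=
  ⋂₀ {X | IsGeodConvex X ∧ S ⊆ X}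

/-- `K` is complete: adding any point increases the diameter (an extended number). -/
def IsDiamComplete {n : ℕ} (K : Set (HypSpace n)) : Prop :=
  ∀ y, y ∉ K → Metric.ediam K < Metric.ediam (K ∪ {y})

/-- The radii of the closed balls that contain `K`. -/
def outerRadii {n : ℕ} (K : Set (HypSpace n)) : Set ℝ :=
  {R | 0 ≤ R ∧ ∃ z, K ⊆ Metric.closedBall z R}

/-- The radii of the closed balls contained in `K`. -/
def innerRadii {n : ℕ} (K : Set (HypSpace n)) : Set ℝ :=
  {r | 0 ≤ r ∧ ∃ z, Metric.closedBall z r ⊆ K}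

/-- The circumradius `R(K)`. -/
noncomputable def circumradius {n : ℕ} (K : Set (HypSpace n)) : ℝ := sInf (outerRadii K)

/-- The inradius `r(K)`. -/
noncomputable def inradius {n : ℕ} (K : Set (HypSpace n)) : ℝ := sSup (innerRadii K)

/-- `Δ` is a regular `n`-simplex of edge length `D` in `Hⁿ`. -/
def IsRegularSimplex {n : ℕ} (D : ℝ) (Δ : Set (HypSpace n)) : Prop :=
  ∃ v : Fin (n + 1) → HypSpace n, (∀ i j, i ≠ j → dist (v i) (v j) = D) ∧
    Δ = geodHull (Set.range v)

/-- `K` contains a congruent copy of `Δ`, i.e. its image under an isometry of `Hⁿ`. -/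
def ContainsCongruentCopy {n : ℕ} (K Δ : Set (HypSpace n)) : Prop :=
  ∃ g : HypSpace n ≃ᵢ HypSpace n, g '' Δ ⊆ K

/-- Regular simplices of every edge length exist. -/
theorem exists_isRegularSimplex (n : ℕ) (D : ℝ) (hD : 0 < D) :
    ∃ Δ : Set (HypSpace n), IsRegularSimplex D Δ := by
  classical
  let E := EuclideanSpace ℝ (Fin (n + 1))
  let o : E := WithLp.toLp 2 fun _ => 1
  have ho : o ≠ 0 := by
    intro h
    have := congrArg (fun w : E => w 0) h
    simp [o] at this
  have hfr : Module.finrank ℝ ((ℝ ∙ o)ᗮ : Submodule ℝ E) = n := by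
    have : Fact (Module.finrank ℝ E = n + 1) := ⟨by simp [E]⟩
    exact Submodule.finrank_orthogonal_span_singleton ho
  let φ := (stdOrthonormalBasis ℝ ((ℝ ∙ o)ᗮ : Submodule ℝ E)).reindex (finCongr hfr) |>.repr
  let w : Fin (n + 1) → E := fun i => EuclideanSpace.single i 1 - ((n + 1 : ℝ)⁻¹) • o
  have hn : (n + 1 : ℝ) ≠ 0 := by positivity
  have hoo : inner ℝ o o = (n + 1 : ℝ) := by
    rw [PiLp.inner_apply]; simp [o]
  have hso : ∀ i, inner ℝ (EuclideanSpace.single i (1 : ℝ) : E) o = 1 := by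
    intro i; rw [EuclideanSpace.inner_single_left]; simp [o]
  have hos : ∀ i, inner ℝ o (EuclideanSpace.single i (1 : ℝ) : E) = 1 := by
    intro i; rw [real_inner_comm]; exact hso i
  have hw : ∀ i, w i ∈ ((ℝ ∙ o)ᗮ : Submodule ℝ E) := by
    intro i
    rw [Submodule.mem_orthogonal_singleton_iff_inner_right]
    simp only [w, inner_sub_right, inner_smul_right, hos, hoo]
    field_simp; ring
  have hww : ∀ i j, inner ℝ (w i) (w j) = (if i = j then 1 else 0) - (n + 1 : ℝ)⁻¹ := by
    intro i j
    have : inner ℝ (EuclideanSpace.single i (1 : ℝ) : E) (EuclideanSpace.single j (1 : ℝ)) =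
        if i = j then 1 else 0 := by
      rw [EuclideanSpace.inner_single_left]; simp
    simp only [w, inner_sub_right, inner_sub_left, inner_smul_right, inner_smul_left, hos, hso,
      hoo, this]
    simp only [conj_trivial]
    field_simp
    ring
  let a := √(Real.cosh D - 1)
  have hcosh : 1 ≤ Real.cosh D := Real.one_le_cosh D
  have ha : a ^ 2 = Real.cosh D - 1 := Real.sq_sqrt (by linarith)
  let p : Fin (n + 1) → EuclideanSpace ℝ (Fin n) := fun i => a • φ ⟨w i, hw i⟩
  have hp : ∀ i j, inner ℝ (p i) (p j) =
      (Real.cosh D - 1) * ((if i = j then 1 else 0) - (n + 1 : ℝ)⁻¹) := by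
    intro i j
    simp only [p, inner_smul_left, inner_smul_right, LinearIsometryEquiv.inner_map_map,
      Submodule.coe_inner, hww, ← ha]
    simp; ring
  let t := √(1 + (Real.cosh D - 1) * (1 - (n + 1 : ℝ)⁻¹))
  have hinv : (n + 1 : ℝ)⁻¹ ≤ 1 := inv_le_one_of_one_le₀ (by
    have : (0 : ℝ) ≤ n := n.cast_nonneg
    linarith)
  have hpos : 0 ≤ (Real.cosh D - 1) * (1 - (n + 1 : ℝ)⁻¹) :=
    mul_nonneg (by linarith) (by linarith)
  have ht : t * t = 1 + (Real.cosh D - 1) * (1 - (n + 1 : ℝ)⁻¹) :=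
    Real.mul_self_sqrt (by linarith)
  let v : Fin (n + 1) → HypSpace n := fun i =>
    { pt := (p i, t)
      one_le := by
        change 1 ≤ t
        exact Real.one_le_sqrt.2 (by linarith)
      form_self := by
        simp only [lorentzForm, hp, ht]; simp }
  refine ⟨_, v, ?_, rfl⟩
  intro i j hij
  change Real.arcosh (lorentzForm (p i, t) (p j, t)) = D
  have : lorentzForm (p i, t) (p j, t) = Real.cosh D := by
    simp only [lorentzForm, hp, ht, hij, if_false]; ring
  rw [this, Real.arcosh_cosh hD.le]

end HypSpace

/-! Write `𝓑` for `lorentzForm`. The circumradius is read off from the ambient Euclidean convex hull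
of `K`. Let `p` maximize `𝓑(p, p)` there. The first variation gives `𝓑(x, p) ≤ 𝓑(p, p)` on `K`, so
the ball about `p / √𝓑(p, p)` whose radius has hyperbolic cosine `√𝓑(p, p)` contains `K`. No smaller
ball does: `p` is a convex combination of points of `K`, and `√𝓑(p, p) ≤ 𝓑(p, z)` for every `z` in
`Hⁿ` by reversed Cauchy–Schwarz (`isLeast_outerRadii`).

At most `n + 1` points `vᵢ` with weights `wᵢ` are needed to represent `p`. With `c = cosh D`,
expanding gives `𝓑(p, p) ≤ c - (c - 1) ∑ wᵢ² ≤ (1 + n c) / (n + 1)`, the value for the regular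
simplex; equality forces `n + 1` points at mutual distance `D` (`sum_sum_mul_le`,
`exists_isLeast_outerRadii`).

A complete set of diameter `D` is the intersection of the balls of radius `D` about its points.
Hence it is compact and convex, and `r(K) + R(K) = D` (`isGreatest_innerRadii`), which turns the
statements on `R` into those on `r`. Equal Gram matrices make regular simplices congruent
(`containsCongruentCopy_of_dist`). -/

namespace HypSpace

/-! ### Lorentzian linear algebra and hyperbolic distance -/

/-- `lorentzForm` as a bilinear form. -/
noncomputable def lorentzBilin (n : ℕ) : LinearMap.BilinForm ℝ (LorentzSpace n) :=
  LinearMap.mk₂ ℝ lorentzForm lorentz_add_left lorentz_smul_left lorentz_add_right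
    lorentz_smul_right

theorem lorentzBilin_apply {n : ℕ} (p q : LorentzSpace n) :
    lorentzBilin n p q = lorentzForm p q := rfl

theorem lorentz_sum_left {n : ℕ} {ι : Type*} (s : Finset ι) (f : ι → LorentzSpace n)
    (q : LorentzSpace n) : lorentzForm (∑ i ∈ s, f i) q = ∑ i ∈ s, lorentzForm (f i) q := by
  simp only [← lorentzBilin_apply, map_sum, LinearMap.sum_apply]

theorem continuous_lorentzForm {n : ℕ} :
    Continuous fun p : LorentzSpace n × LorentzSpace n => lorentzForm p.1 p.2 := by
  unfold lorentzForm
  fun_prop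

theorem cosh_dist {n : ℕ} (x y : HypSpace n) :
    Real.cosh (dist x y) = lorentzForm x.pt y.pt :=
  Real.cosh_arcosh (one_le_lorentz x y)

theorem dist_le_iff {n : ℕ} (x y : HypSpace n) {R : ℝ} (hR : 0 ≤ R) :
    dist x y ≤ R ↔ lorentzForm x.pt y.pt ≤ Real.cosh R := by
  rw [← cosh_dist, Real.cosh_le_cosh, abs_of_nonneg dist_nonneg, abs_of_nonneg hR]

theorem dist_eq_iff {n : ℕ} (x y : HypSpace n) {R : ℝ} (hR : 0 ≤ R) :
    dist x y = R ↔ lorentzForm x.pt y.pt = Real.cosh R := by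
  rw [← cosh_dist]
  exact ⟨fun h => h ▸ rfl, fun h => Real.cosh_strictMonoOn.injOn dist_nonneg hR h⟩

/-- A unit timelike vector pairing positively with a point of `Hⁿ` lies on the upper sheet. -/
theorem one_le_snd_of_lorentz_pos {n : ℕ} {q : LorentzSpace n} (hq : lorentzForm q q = 1)
    (z : HypSpace n) (hz : 0 < lorentzForm q z.pt) : 1 ≤ q.2 := by
  simp only [lorentzForm, real_inner_self_eq_norm_sq] at hq
  have h1 := normSq_eq z
  have h2 := z.one_le
  have h3 := (abs_le.1 (abs_real_inner_le_norm q.1 z.pt.1)).1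
  have h4 := norm_nonneg q.1
  have h5 : ‖z.pt.1‖ ≤ z.pt.2 := abs_le_of_sq_le_sq' (by linarith) (by linarith) |>.2
  unfold lorentzForm at hz
  by_contra hc
  have h6 : q.2 ≤ 0 := by
    by_contra h
    nlinarith [sq_nonneg ‖q.1‖]
  have h7 : ‖q.1‖ ≤ -q.2 := abs_le_of_sq_le_sq' (by nlinarith) (by linarith) |>.2
  nlinarith [mul_le_mul_of_nonneg_left h5 h4]

/-- The radial projection of a vector inside the future cone to `Hⁿ`. -/
noncomputable def normalize {n : ℕ} (p : LorentzSpace n) (hp : 0 < lorentzForm p p)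
    (hp2 : 0 ≤ p.2) : HypSpace n where
  pt := (√(lorentzForm p p))⁻¹ • p
  one_le := by
    have hs : 0 < √(lorentzForm p p) := Real.sqrt_pos.2 hp
    have h : √(lorentzForm p p) ≤ p.2 := by
      refine Real.sqrt_le_iff.2 ⟨hp2, ?_⟩
      unfold lorentzForm
      nlinarith [real_inner_self_nonneg (x := p.1)]
    change 1 ≤ (√(lorentzForm p p))⁻¹ * p.2
    rw [inv_mul_eq_div, le_div_iff₀ hs]
    linarith
  form_self := by
    rw [lorentz_smul_left, lorentz_smul_right]
    have hs : 0 < √(lorentzForm p p) := Real.sqrt_pos.2 hp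
    field_simp
    exact (Real.sq_sqrt hp.le).symm

theorem lorentz_normalize {n : ℕ} (p q : LorentzSpace n) (hp : 0 < lorentzForm p p)
    (hp2 : 0 ≤ p.2) :
    lorentzForm q (normalize p hp hp2).pt = lorentzForm q p / √(lorentzForm p p) := by
  change lorentzForm q ((√(lorentzForm p p))⁻¹ • p) = _
  rw [lorentz_smul_right, inv_mul_eq_div]

/-- The reversed Cauchy–Schwarz inequality. -/
theorem sqrt_lorentz_le {n : ℕ} {p : LorentzSpace n} (hp : 0 < lorentzForm p p)
    (hp2 : 0 ≤ p.2) (z : HypSpace n) : √(lorentzForm p p) ≤ lorentzForm p z.pt := by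
  have h := one_le_lorentz z (normalize p hp hp2)
  rwa [lorentz_normalize, one_le_div (Real.sqrt_pos.2 hp), lorentz_comm z.pt] at h

/-! ### Enclosing balls and convexity -/

/-- A weighted mean with future timelike value whose pairings with `K` are at most its square
determines the smallest ball containing `K`. -/
theorem isLeast_outerRadii {n : ℕ} {K : Set (HypSpace n)} {ι : Type*} [Fintype ι] [Nonempty ι]
    (v : ι → HypSpace n) (w : ι → ℝ) (hv : ∀ i, v i ∈ K) (hw : ∀ i, 0 < w i)
    (hw1 : ∑ i, w i = 1) (p : LorentzSpace n) (hp : p = ∑ i, w i • (v i).pt)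
    (hpp : 1 ≤ lorentzForm p p) (hK : ∀ x ∈ K, lorentzForm x.pt p ≤ lorentzForm p p) :
    IsLeast (outerRadii K) (Real.arcosh (√(lorentzForm p p))) := by
  have hp2 : 0 ≤ p.2 := by
    rw [hp, Prod.snd_sum]
    exact Finset.sum_nonneg fun i _ => mul_nonneg (hw i).le (by linarith [(v i).one_le])
  have hp0 : 0 < lorentzForm p p := by linarith
  have hs : 1 ≤ √(lorentzForm p p) := Real.one_le_sqrt.2 hpp
  constructor
  · refine ⟨Real.arcosh_nonneg hs, normalize p hp0 hp2, fun x hx => ?_⟩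
    rw [Metric.mem_closedBall, dist_le_iff _ _ (Real.arcosh_nonneg hs), Real.cosh_arcosh hs,
      lorentz_normalize, div_le_iff₀ (by linarith), Real.mul_self_sqrt hp0.le]
    exact hK x hx
  · rintro R ⟨hR, z, hz⟩
    rw [← Real.arcosh_cosh hR, Real.arcosh_le_arcosh (by linarith) (Real.cosh_pos _)]
    -- The average of the values `cosh d(v i, z)` is `𝓑(p, z)`, which is at least `√𝓑(p, p)`.
    refine (sqrt_lorentz_le hp0 hp2 z).trans ?_
    conv_lhs => rw [hp]
    rw [lorentz_sum_left]
    calc ∑ i, lorentzForm (w i • (v i).pt) z.pt ≤ ∑ i, w i * Real.cosh R := by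
          refine Finset.sum_le_sum fun i _ => ?_
          rw [lorentz_smul_left]
          exact mul_le_mul_of_nonneg_left ((dist_le_iff _ _ hR).1 (hz (hv i))) (hw i).le
      _ = Real.cosh R := by rw [← Finset.sum_mul, hw1, one_mul]

/-- A point of the segment is `(sinh (T - s) x + sinh s y) / sinh T`. By superadditivity of `sinh`
on `[0, ∞)` the coefficients sum to at most `1`, so an upper bound `cosh R` for pairings with `c`
persists. -/
theorem isGeodConvex_closedBall {n : ℕ} (c : HypSpace n) {R : ℝ} (hR : 0 ≤ R) :
    IsGeodConvex (Metric.closedBall c R) := by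
  rintro x hx y hy z ⟨u, hux, huu, T, s, hs, hsT, hyT, hzs⟩
  rw [Metric.mem_closedBall, dist_le_iff _ _ hR] at *
  rcases (hs.trans hsT).eq_or_lt with hT | hT
  · obtain rfl : s = 0 := by linarith
    rw [hzs]
    simpa using hx
  · have hTs : 0 < Real.sinh T := Real.sinh_pos_iff.2 hT
    have ha : 0 ≤ Real.sinh (T - s) := Real.sinh_nonneg_iff.2 (by linarith)
    have hb : 0 ≤ Real.sinh s := Real.sinh_nonneg_iff.2 hs
    have hab : Real.sinh (T - s) + Real.sinh s ≤ Real.sinh T := by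
      have h : Real.sinh T = Real.sinh ((T - s) + s) := by rw [sub_add_cancel]
      rw [h, Real.sinh_add]
      nlinarith [Real.one_le_cosh s, Real.one_le_cosh (T - s)]
    have hy' := hy
    rw [hyT, lorentz_add_left, lorentz_smul_left, lorentz_smul_left] at hy'
    have key : Real.sinh T * lorentzForm z.pt c.pt =
        Real.sinh (T - s) * lorentzForm x.pt c.pt + Real.sinh s *
          (Real.cosh T * lorentzForm x.pt c.pt + Real.sinh T * lorentzForm u c.pt) := by
      rw [hzs, lorentz_add_left, lorentz_smul_left, lorentz_smul_left, Real.sinh_sub]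
      ring
    have h1 := mul_le_mul_of_nonneg_left hx ha
    have h2 := mul_le_mul_of_nonneg_left hy' hb
    have h3 := mul_le_mul_of_nonneg_right hab (Real.cosh_pos R).le
    exact le_of_mul_le_mul_left (by linarith) hTs

theorem subset_geodHull {n : ℕ} (S : Set (HypSpace n)) : S ⊆ geodHull S :=
  fun _ hx _ hX => hX.2 hx

/-- The geodesic from `x` to `z` can be prolonged beyond `z` by any length. -/
theorem exists_dist_eq_add {n : ℕ} {x z : HypSpace n} (hxz : x ≠ z) {r : ℝ} (hr : 0 ≤ r) :
    ∃ y, dist y z = r ∧ dist x y = dist x z + r := by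
  set T := dist x z with hTdef
  have hT : 0 < T := dist_pos.2 hxz
  have hsT : Real.sinh T ≠ 0 := (Real.sinh_pos_iff.2 hT).ne'
  have hxz' : lorentzForm x.pt z.pt = Real.cosh T := (cosh_dist x z).symm
  have hsq := Real.cosh_sq T
  have hsr := Real.cosh_sq r
  set k := Real.sinh r / Real.sinh T with hk
  have hk' : k * Real.sinh T = Real.sinh r := div_mul_cancel₀ _ hsT
  -- This is `cosh r · z + sinh r · u`, where `u = (cosh T · z - x) / sinh T` is the unit tangent
  -- vector at `z` pointing away from `x`.
  set q : LorentzSpace n := (Real.cosh r + k * Real.cosh T) • z.pt + (-k) • x.pt with hq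
  have hqz : lorentzForm q z.pt = Real.cosh r := by
    rw [hq, lorentz_add_left, lorentz_smul_left, lorentz_smul_left, z.form_self, hxz']
    ring
  have hqx : lorentzForm q x.pt = Real.cosh (T + r) := by
    rw [hq, lorentz_add_left, lorentz_smul_left, lorentz_smul_left, x.form_self,
      lorentz_comm z.pt, hxz', Real.cosh_add, ← hk']
    linear_combination k * hsq
  have hqq : lorentzForm q q = 1 := by
    conv_lhs => rw [hq]
    rw [lorentz_add_left, lorentz_smul_left, lorentz_smul_left, lorentz_comm z.pt,
      lorentz_comm x.pt, hqz, hqx, Real.cosh_add]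
    linear_combination hsr - Real.sinh r * hk'
  refine ⟨⟨q, one_le_snd_of_lorentz_pos hqq z (hqz ▸ Real.cosh_pos r), hqq⟩, ?_, ?_⟩
  · exact (dist_eq_iff _ _ hr).2 hqz
  · rw [dist_eq_iff _ _ (by linarith), lorentz_comm]
    exact hqx

/-! ### Isometries from linear maps -/

/-- A linear map preserving the form and mapping one point of `Hⁿ` into `Hⁿ` maps `Hⁿ`
into itself. -/
noncomputable def mapOfLinear {n : ℕ} (L : LorentzSpace n →ₗ[ℝ] LorentzSpace n)
    (hL : ∀ p q, lorentzForm (L p) (L q) = lorentzForm p q) (a b : HypSpace n)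
    (hab : L a.pt = b.pt) (x : HypSpace n) : HypSpace n where
  pt := L x.pt
  one_le := one_le_snd_of_lorentz_pos (by rw [hL, x.form_self]) b (by
    rw [← hab, hL]
    linarith [one_le_lorentz x a])
  form_self := by rw [hL, x.form_self]

/-- The isometry of `Hⁿ` induced by a linear automorphism preserving the form. -/
noncomputable def isometryEquivOfLinear {n : ℕ} (L : LorentzSpace n ≃ₗ[ℝ] LorentzSpace n)
    (hL : ∀ p q, lorentzForm (L p) (L q) = lorentzForm p q) (a b : HypSpace n)
    (hab : L a.pt = b.pt) : HypSpace n ≃ᵢ HypSpace n where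
  toFun := mapOfLinear L.toLinearMap hL a b hab
  invFun := mapOfLinear L.symm.toLinearMap
    (fun p q => by rw [← hL]; simp) b a (by simp [← hab])
  left_inv x := HypSpace.ext (L.symm_apply_apply x.pt)
  right_inv x := HypSpace.ext (L.apply_symm_apply x.pt)
  isometry_toFun := Isometry.of_dist_eq fun x y => by
    change Real.arcosh (lorentzForm (L x.pt) (L y.pt)) = _
    rw [hL]
    rfl

theorem isGeodConvex_preimage {n : ℕ} (L : LorentzSpace n ≃ₗ[ℝ] LorentzSpace n)
    (hL : ∀ p q, lorentzForm (L p) (L q) = lorentzForm p q) (a b : HypSpace n)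
    (hab : L a.pt = b.pt) {K : Set (HypSpace n)} (hK : IsGeodConvex K) :
    IsGeodConvex (isometryEquivOfLinear L hL a b hab ⁻¹' K) := by
  rintro x hx y hy z ⟨u, hux, huu, T, s, hs, hsT, hyT, hzs⟩
  refine hK _ hx _ hy ⟨L u, (hL _ _).trans hux, by rw [hL, huu], T, s, hs, hsT, ?_, ?_⟩
  · change L y.pt = Real.cosh T • L x.pt + Real.sinh T • L u
    rw [hyT, map_add, map_smul, map_smul]
  · change L z.pt = Real.cosh s • L x.pt + Real.sinh s • L u
    rw [hzs, map_add, map_smul, map_smul]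

/-! ### Regular simplices -/

theorem lorentz_of_dist {n : ℕ} {D : ℝ} {v : Fin (n + 1) → HypSpace n}
    (hv : ∀ i j, i ≠ j → dist (v i) (v j) = D) (i j : Fin (n + 1)) :
    lorentzForm (v i).pt (v j).pt = Real.cosh D + if i = j then 1 - Real.cosh D else 0 := by
  split_ifs with h
  · rw [h, (v j).form_self]
    ring
  · rw [← cosh_dist, hv i j h, add_zero]

theorem sum_lorentz_of_dist {n : ℕ} {D : ℝ} {v : Fin (n + 1) → HypSpace n}
    (hv : ∀ i j, i ≠ j → dist (v i) (v j) = D) (c : Fin (n + 1) → ℝ) (j : Fin (n + 1)) :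
    lorentzForm (∑ i, c i • (v i).pt) (v j).pt =
      Real.cosh D * (∑ i, c i) + c j * (1 - Real.cosh D) := by
  simp only [lorentz_sum_left, lorentz_smul_left, lorentz_of_dist hv, mul_add,
    Finset.sum_add_distrib, mul_ite, mul_zero, Finset.sum_ite_eq', Finset.mem_univ, if_true,
    ← Finset.sum_mul]
  ring

/-- The Gram matrix `cosh D · J + (1 - cosh D) · I`, with `J` the all-ones matrix, is invertible:
summing the equations of a relation gives `(1 + n cosh D) ∑ cᵢ = 0`, and then each `cⱼ` vanishes. -/
theorem linearIndependent_of_dist {n : ℕ} {D : ℝ} (hD : 0 < D) {v : Fin (n + 1) → HypSpace n}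
    (hv : ∀ i j, i ≠ j → dist (v i) (v j) = D) :
    LinearIndependent ℝ fun i => (v i).pt := by
  have hC : 1 < Real.cosh D := Real.one_lt_cosh.2 hD.ne'
  rw [Fintype.linearIndependent_iff]
  intro c hc
  have h : ∀ j, Real.cosh D * (∑ i, c i) + c j * (1 - Real.cosh D) = 0 := fun j => by
    rw [← sum_lorentz_of_dist hv, hc]
    simp [lorentzForm]
  have h1 := Finset.sum_eq_zero fun j (_ : j ∈ Finset.univ) => h j
  rw [Finset.sum_add_distrib, ← Finset.sum_mul Finset.univ c] at h1
  simp only [Finset.sum_const, Finset.card_univ, Fintype.card_fin, nsmul_eq_mul] at h1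
  push_cast at h1
  have h2 : (∑ i, c i) * (1 + n * Real.cosh D) = 0 := by linear_combination h1
  have h3 : ∑ i, c i = 0 := (mul_eq_zero.1 h2).resolve_right (by positivity)
  intro j
  have h4 := h j
  rw [h3, mul_zero, zero_add] at h4
  exact (mul_eq_zero.1 h4).resolve_right (by linarith)

theorem finrank_lorentzSpace (n : ℕ) : Module.finrank ℝ (LorentzSpace n) = n + 1 := by
  simp

/-- Regular simplices of equal edge length are congruent. -/
theorem containsCongruentCopy_of_dist {n : ℕ} {D : ℝ} (hD : 0 < D)
    {v w : Fin (n + 1) → HypSpace n} (hv : ∀ i j, i ≠ j → dist (v i) (v j) = D)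
    (hw : ∀ i j, i ≠ j → dist (w i) (w j) = D) {K : Set (HypSpace n)} (hK : IsGeodConvex K)
    (hwK : ∀ i, w i ∈ K) : ContainsCongruentCopy K (geodHull (Set.range v)) := by
  have hcard : Fintype.card (Fin (n + 1)) = Module.finrank ℝ (LorentzSpace n) := by simp
  let bv := basisOfLinearIndependentOfCardEqFinrank (linearIndependent_of_dist hD hv) hcard
  let bw := basisOfLinearIndependentOfCardEqFinrank (linearIndependent_of_dist hD hw) hcard
  let L := bv.equiv bw (Equiv.refl _)
  have hLv : ∀ i, L (v i).pt = (w i).pt := fun i => by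
    have h := bv.equiv_apply i bw (Equiv.refl _)
    simpa [bv, bw, L] using h
  -- The two vertex bases have the same Gram matrix.
  have hL : ∀ p q, lorentzForm (L p) (L q) = lorentzForm p q := by
    have h : (lorentzBilin n).comp L.toLinearMap L.toLinearMap = lorentzBilin n := by
      refine LinearMap.BilinForm.ext_basis bv fun i j => ?_
      have h' : lorentzForm (L (v i).pt) (L (v j).pt) = lorentzForm (v i).pt (v j).pt := by
        rw [hLv, hLv, lorentz_of_dist hv, lorentz_of_dist hw]
      simpa [bv, LinearMap.BilinForm.comp_apply, lorentzBilin_apply] using h'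
    intro p q
    exact congrArg (fun B : LinearMap.BilinForm ℝ (LorentzSpace n) => B p q) h
  refine ⟨isometryEquivOfLinear L hL (v 0) (w 0) (hLv 0), Set.image_subset_iff.2 ?_⟩
  intro x hx
  -- The preimage of `K` is convex, so it contains the hull once it contains the vertices.
  refine hx _ ⟨isGeodConvex_preimage L hL _ _ _ hK, ?_⟩
  rintro _ ⟨i, rfl⟩
  have : isometryEquivOfLinear L hL (v 0) (w 0) (hLv 0) (v i) = w i :=
    HypSpace.ext (hLv i)
  rw [Set.mem_preimage, this]
  exact hwK i

/-- The squared hyperbolic cosine of the circumradius of the regular simplex is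
`(1 + n cosh D) / (n + 1)`. -/
theorem isLeast_outerRadii_of_dist {n : ℕ} {D : ℝ} {v : Fin (n + 1) → HypSpace n}
    (hv : ∀ i j, i ≠ j → dist (v i) (v j) = D) :
    IsLeast (outerRadii (Set.range v))
      (Real.arcosh (√((1 + n * Real.cosh D) / (n + 1)))) := by
  have hn : (n + 1 : ℝ) ≠ 0 := by positivity
  have hC : 1 ≤ Real.cosh D := Real.one_le_cosh D
  set p : LorentzSpace n := ∑ i, ((n + 1 : ℝ)⁻¹) • (v i).pt with hp
  have hw1 : ∑ _i : Fin (n + 1), ((n + 1 : ℝ)⁻¹) = 1 := by simp [hn]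
  have hpv : ∀ j, lorentzForm p (v j).pt = (1 + n * Real.cosh D) / (n + 1) := fun j => by
    rw [hp, sum_lorentz_of_dist hv, hw1]
    field_simp
    ring
  have hpp : lorentzForm p p = (1 + n * Real.cosh D) / (n + 1) := by
    have hvp : ∀ j, lorentzForm (v j).pt p = (1 + n * Real.cosh D) / (n + 1) := fun j => by
      rw [lorentz_comm, hpv]
    have h : lorentzForm p p = ∑ i, ((n + 1 : ℝ)⁻¹) * lorentzForm (v i).pt p := by
      conv_lhs => rw [hp, lorentz_sum_left, ← hp]
      simp only [lorentz_smul_left]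
    simp only [h, hvp, ← Finset.sum_mul, hw1, one_mul]
  rw [← hpp]
  refine isLeast_outerRadii v (fun _ => (n + 1 : ℝ)⁻¹) Set.mem_range_self
    (fun i => by positivity) hw1 p hp ?_ ?_
  · rw [hpp, one_le_div (by positivity)]
    nlinarith [(n.cast_nonneg : (0 : ℝ) ≤ n)]
  · rintro _ ⟨j, rfl⟩
    rw [lorentz_comm, hpv, hpp]

theorem outerRadii_geodHull {n : ℕ} (S : Set (HypSpace n)) :
    outerRadii (geodHull S) = outerRadii S := by
  ext R
  constructor
  · rintro ⟨hR, z, hz⟩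
    exact ⟨hR, z, (subset_geodHull S).trans hz⟩
  · rintro ⟨hR, z, hz⟩
    exact ⟨hR, z, fun x hx => hx _ ⟨isGeodConvex_closedBall z hR, hz⟩⟩

/-! ### Jung's theorem -/

/-- The weighted mean of a Gram matrix with unit diagonal and entries at most `c`. -/
theorem sum_sum_mul_le {ι : Type*} [Fintype ι] {n : ℕ} (hcard : Fintype.card ι ≤ n + 1)
    {w : ι → ℝ} (hw : ∀ i, 0 < w i) (hw1 : ∑ i, w i = 1) {G : ι → ι → ℝ} {c : ℝ} (hc : 1 < c)
    (hG1 : ∀ i, G i i = 1) (hG : ∀ i j, G i j ≤ c) :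
    ∑ i, ∑ j, w i * w j * G i j ≤ (1 + n * c) / (n + 1) ∧
      (∑ i, ∑ j, w i * w j * G i j = (1 + n * c) / (n + 1) →
        Fintype.card ι = n + 1 ∧ ∀ i j, i ≠ j → G i j = c) := by
  classical
  have hn : (0 : ℝ) < n + 1 := by positivity
  set S := ∑ i, w i ^ 2 with hS
  have hS0 : 0 < S := by
    have hne : (Finset.univ : Finset ι).Nonempty := by
      by_contra h
      rw [Finset.not_nonempty_iff_eq_empty] at h
      simp [h] at hw1
    exact Finset.sum_pos (fun i _ => pow_pos (hw i) 2) hne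
  have hS1 : 1 ≤ (Fintype.card ι : ℝ) * S := by
    have h := sq_sum_le_card_mul_sum_sq (s := (Finset.univ : Finset ι)) (f := w)
    rw [hw1, Finset.card_univ] at h
    linarith
  have hcard' : (Fintype.card ι : ℝ) ≤ n + 1 := by exact_mod_cast hcard
  -- The weighted deficit of `G` from the extremal matrix with diagonal `1` and all other entries
  -- `c`; it vanishes on the diagonal.
  set t : ι → ι → ℝ := fun i j => w i * w j * (c - G i j - if i = j then c - 1 else 0) with ht
  have ht0 : ∀ i j, 0 ≤ t i j := fun i j => by
    refine mul_nonneg (mul_pos (hw i) (hw j)).le ?_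
    split_ifs with h
    · rw [h, hG1]
      linarith
    · linarith [hG i j]
  have hsum : ∑ i, ∑ j, w i * w j * G i j = c - (c - 1) * S - ∑ i, ∑ j, t i j := by
    have h1 : ∑ i, ∑ j, t i j =
        ∑ i, (w i * c - ∑ j, w i * w j * G i j - w i ^ 2 * (c - 1)) := by
      refine Finset.sum_congr rfl fun i _ => ?_
      simp only [ht, mul_sub, Finset.sum_sub_distrib, mul_ite, mul_zero, Finset.sum_ite_eq,
        Finset.mem_univ, if_true]
      rw [← Finset.sum_mul, ← Finset.mul_sum, hw1]
      ring
    rw [h1, Finset.sum_sub_distrib, Finset.sum_sub_distrib, ← Finset.sum_mul, ← Finset.sum_mul,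
      hw1]
    ring
  have ht1 : 0 ≤ ∑ i, ∑ j, t i j :=
    Finset.sum_nonneg fun i _ => Finset.sum_nonneg fun j _ => ht0 i j
  have hval : (1 + n * c) / (n + 1) = c - (c - 1) / (n + 1) := by
    field_simp
    ring
  have hSn : 1 / (n + 1 : ℝ) ≤ S := by
    rw [div_le_iff₀ hn]
    nlinarith
  have hSn' : (c - 1) / (n + 1) ≤ (c - 1) * S := by
    rw [div_eq_mul_one_div]
    exact mul_le_mul_of_nonneg_left hSn (by linarith)
  rw [hsum, hval]
  refine ⟨by linarith, fun h => ?_⟩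
  -- Both losses, `∑ t` and `S - 1 / (n + 1)`, are nonnegative, so equality kills both.
  have hT : ∑ i, ∑ j, t i j = 0 := by linarith
  have hSe : (c - 1) * S = (c - 1) * (1 / (n + 1)) := by
    rw [← div_eq_mul_one_div]
    linarith
  have hSe' : S = 1 / (n + 1) := mul_left_cancel₀ (by linarith) hSe
  constructor
  · refine le_antisymm hcard ?_
    rw [hSe', mul_one_div, le_div_iff₀ hn, one_mul] at hS1
    exact_mod_cast hS1
  · intro i j hij
    have h1 := (Finset.sum_eq_zero_iff_of_nonneg fun i _ =>
      Finset.sum_nonneg fun j _ => ht0 i j).1 hT i (Finset.mem_univ i)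
    have h2 := (Finset.sum_eq_zero_iff_of_nonneg fun j _ => ht0 i j).1 h1 j (Finset.mem_univ j)
    simp only [ht, hij, if_false, sub_zero] at h2
    have h3 := (mul_eq_zero.1 h2).resolve_left (mul_pos (hw i) (hw j)).ne'
    linarith

/-- In finite dimension the convex hull of a compact set is compact. -/
theorem isCompact_convexHull_of_finiteDimensional {E : Type*} [NormedAddCommGroup E]
    [NormedSpace ℝ E] [FiniteDimensional ℝ E] {s : Set E} (hs : IsCompact s) :
    IsCompact (convexHull ℝ s) := by
  rcases s.eq_empty_or_nonempty with rfl | ⟨x₀, hx₀⟩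
  · simp
  -- By Carathéodory, `m` points suffice, so the hull is a continuous image of the simplex times
  -- `sᵐ`. Unused slots receive weight `0` and the dummy point `x₀`.
  let m := Module.finrank ℝ E + 1
  let F : (Fin m → ℝ) × (Fin m → E) → E := fun q => ∑ i, q.1 i • q.2 i
  have hF : Continuous F := by fun_prop
  have hc := ((isCompact_stdSimplex ℝ (Fin m)).prod
    (isCompact_univ_pi fun _ : Fin m => hs)).image hF
  convert hc using 1
  ext x
  constructor
  · intro hx
    obtain ⟨ι, _, z, w, hz, hai, hw, hw1, rfl⟩ := eq_pos_convex_span_of_mem_convexHull hx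
    have hcard : Fintype.card ι ≤ Fintype.card (Fin m) := by
      rw [Fintype.card_fin]
      exact hai.card_le_finrank_succ.trans (Nat.succ_le_succ (Submodule.finrank_le _))
    obtain ⟨e⟩ := Function.Embedding.nonempty_of_card_le hcard
    have hw' : ∀ i, Function.extend e w (0 : Fin m → ℝ) (e i) = w i := e.injective.extend_apply w _
    have hz' : ∀ i, Function.extend e z (fun _ => x₀) (e i) = z i :=
      e.injective.extend_apply z _
    have hw0 : ∀ j ∉ Set.range e, Function.extend e w (0 : Fin m → ℝ) j = 0 := fun j hj =>
      Function.extend_apply' w (0 : Fin m → ℝ) j hj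
    refine ⟨(Function.extend e w 0, Function.extend e z fun _ => x₀), ⟨⟨fun j => ?_, ?_⟩,
      fun j _ => ?_⟩, ?_⟩
    · by_cases hj : j ∈ Set.range e
      · obtain ⟨i, rfl⟩ := hj
        exact (hw i).le.trans_eq (hw' i).symm
      · exact (hw0 j hj).ge
    · rw [← hw1]
      exact (Fintype.sum_of_injective e e.injective w _ hw0 fun i => (hw' i).symm).symm
    · by_cases hj : j ∈ Set.range e
      · obtain ⟨i, rfl⟩ := hj
        change Function.extend e z (fun _ => x₀) (e i) ∈ s
        rw [hz' i]
        exact hz ⟨i, rfl⟩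
      · change Function.extend e z (fun _ => x₀) j ∈ s
        rwa [Function.extend_apply' z _ j hj]
    · refine (Fintype.sum_of_injective e e.injective _ _ (fun j hj => ?_) fun i => ?_).symm
      · simp only [hw0 j hj, zero_smul]
      · simp only [hw', hz']
  · rintro ⟨⟨w, z⟩, ⟨⟨hw, hw1⟩, hz⟩, rfl⟩
    exact (convex_convexHull ℝ s).sum_mem (fun i _ => hw i) hw1
      fun i _ => subset_convexHull ℝ s (hz i trivial)

/-- Jung's theorem for compact sets in `Hⁿ`. -/
theorem exists_isLeast_outerRadii {n : ℕ} {K : Set (HypSpace n)} {D : ℝ} (hD : 0 < D)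
    (hK : IsCompact (HypSpace.pt '' K)) (hne : K.Nonempty)
    (hKD : ∀ x ∈ K, ∀ y ∈ K, dist x y ≤ D) :
    ∃ q : ℝ, 1 ≤ q ∧ IsLeast (outerRadii K) (Real.arcosh (√q)) ∧
      q ≤ (1 + n * Real.cosh D) / (n + 1) ∧
      (q = (1 + n * Real.cosh D) / (n + 1) →
        ∃ v : Fin (n + 1) → HypSpace n, (∀ i, v i ∈ K) ∧
          ∀ i j, i ≠ j → dist (v i) (v j) = D) := by
  obtain ⟨x₀, hx₀⟩ := hne
  have hcont : Continuous fun p : LorentzSpace n => lorentzForm p p :=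
    continuous_lorentzForm.comp (continuous_id.prodMk continuous_id)
  obtain ⟨p, hpK, hmax⟩ := (isCompact_convexHull_of_finiteDimensional hK).exists_isMaxOn
    ⟨x₀.pt, subset_convexHull ℝ _ ⟨x₀, hx₀, rfl⟩⟩ hcont.continuousOn
  have hmax' : ∀ x ∈ convexHull ℝ (HypSpace.pt '' K), lorentzForm x x ≤ lorentzForm p p := hmax
  have hpp : 1 ≤ lorentzForm p p := by
    have := hmax' x₀.pt (subset_convexHull ℝ _ ⟨x₀, hx₀, rfl⟩)
    rwa [x₀.form_self] at this
  have hxp : ∀ x ∈ K, lorentzForm x.pt p ≤ lorentzForm p p := by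
    intro x hx
    set a := lorentzForm x.pt p with ha
    set b := lorentzForm p p with hb
    by_contra hlt
    push Not at hlt
    have hseg : ∀ t : ℝ, 0 ≤ t → t ≤ 1 →
        (1 - t) ^ 2 * b + 2 * t * (1 - t) * a + t ^ 2 ≤ b := fun t ht0 ht1 => by
      have h := hmax' ((1 - t) • p + t • x.pt) (convex_convexHull ℝ _ hpK
        (subset_convexHull ℝ _ ⟨x, hx, rfl⟩) (by linarith) ht0 (by ring))
      simp only [lorentz_add_left, lorentz_smul_left, lorentz_add_right, lorentz_smul_right,
        x.form_self, lorentz_comm p x.pt, ← ha, ← hb] at h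
      linarith
    have hd : 0 < 2 * a - b := by linarith
    -- This `t` maximizes `2 t (a - b) - t² (2 a - b)`, the gain along the segment from `p` to `x`
    -- without its positive term `t²`.
    have ht0 : 0 < (a - b) / (2 * a - b) := div_pos (by linarith) hd
    have ht1 : (a - b) / (2 * a - b) ≤ 1 := by
      rw [div_le_one hd]
      linarith
    have h := hseg _ ht0.le ht1
    set t := (a - b) / (2 * a - b) with htdef
    have htd : t * (2 * a - b) = a - b := div_mul_cancel₀ _ hd.ne'
    have : t * (a - b) + t ^ 2 ≤ 0 := by nlinarith
    nlinarith [mul_pos ht0 (sub_pos.2 hlt)]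
  obtain ⟨ι, _, z, w, hz, hai, hw, hw1, hzp⟩ := eq_pos_convex_span_of_mem_convexHull hpK
  choose v hvK hvz using fun i => hz ⟨i, rfl⟩
  have hne : Nonempty ι := by
    by_contra h
    rw [not_nonempty_iff] at h
    simp at hw1
  have hpv : p = ∑ i, w i • (v i).pt := by simp only [hvz, hzp]
  -- The numbers `𝓑(vᵢ, p)` have weighted mean `𝓑(p, p)` and none exceeds it.
  have hvp : ∀ i, lorentzForm (v i).pt p = lorentzForm p p := by
    have h : ∑ i, w i * (lorentzForm p p - lorentzForm (v i).pt p) = 0 := by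
      simp only [mul_sub, Finset.sum_sub_distrib]
      rw [← Finset.sum_mul, hw1, one_mul, sub_eq_zero]
      simp only [← lorentz_smul_left, ← lorentz_sum_left, ← hpv]
    intro i
    have h1 := (Finset.sum_eq_zero_iff_of_nonneg fun i _ =>
      mul_nonneg (hw i).le (sub_nonneg.2 (hxp _ (hvK i)))).1 h i (Finset.mem_univ i)
    have h2 := (mul_eq_zero.1 h1).resolve_left (hw i).ne'
    linarith
  -- Carathéodory in `ℝⁿ⁺¹` alone would allow `n + 2` points. Here all lie on the hyperplane `𝓑(·,
  -- p) = 𝓑(p, p)`, which misses the origin, so affine independence becomes linear independence.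
  have hcard : Fintype.card ι ≤ n + 1 := by
    have hli : LinearIndependent ℝ z := by
      rw [Fintype.linearIndependent_iff]
      intro c hc
      have h1 : (∑ i, c i) * lorentzForm p p = 0 := by
        calc (∑ i, c i) * lorentzForm p p = lorentzForm (∑ i, c i • z i) p := by
              simp only [lorentz_sum_left, lorentz_smul_left, ← hvz, hvp, Finset.sum_mul]
          _ = 0 := by rw [hc]; simp [lorentzForm]
      have h2 : ∑ i, c i = 0 := (mul_eq_zero.1 h1).resolve_right (by linarith)
      have h3 := (affineIndependent_iff.1 hai) Finset.univ c h2 hc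
      exact fun i => h3 i (Finset.mem_univ i)
    rw [← finrank_lorentzSpace n]
    exact hli.fintype_card_le_finrank
  have hsum : lorentzForm p p = ∑ i, ∑ j, w i * w j * lorentzForm (v i).pt (v j).pt := by
    conv_lhs => rw [hpv]
    simp only [lorentz_sum_left, lorentz_smul_left]
    refine Finset.sum_congr rfl fun i _ => ?_
    rw [lorentz_comm, lorentz_sum_left, Finset.mul_sum]
    refine Finset.sum_congr rfl fun j _ => ?_
    rw [lorentz_smul_left, lorentz_comm]
    ring
  obtain ⟨hle, heq⟩ := sum_sum_mul_le hcard hw hw1 (Real.one_lt_cosh.2 hD.ne')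
    (fun i => (v i).form_self) (fun i j => (dist_le_iff _ _ hD.le).1 (hKD _ (hvK i) _ (hvK j)))
  refine ⟨lorentzForm p p, hpp, isLeast_outerRadii v w hvK hw hw1 p hpv hpp hxp,
    hsum ▸ hle, fun h => ?_⟩
  obtain ⟨hc, hd⟩ := heq (hsum ▸ h)
  let e := (Fintype.equivFinOfCardEq hc).symm
  exact ⟨v ∘ e, fun i => hvK _, fun i j hij =>
    (dist_eq_iff _ _ hD.le).2 (hd _ _ (e.injective.ne hij))⟩

/-! ### Complete sets -/

section Complete

variable {n : ℕ} {K : Set (HypSpace n)} {D : ℝ}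

theorem dist_le_of_ediam (hKD : Metric.ediam K = ENNReal.ofReal D) (hD : 0 < D)
    {x y : HypSpace n} (hx : x ∈ K) (hy : y ∈ K) : dist x y ≤ D := by
  rw [← ENNReal.ofReal_le_ofReal_iff hD.le, ← edist_dist, ← hKD]
  exact Metric.edist_le_ediam_of_mem hx hy

theorem nontrivial_of_ediam (hKD : Metric.ediam K = ENNReal.ofReal D) (hD : 0 < D) :
    K.Nontrivial := by
  rw [← Metric.ediam_pos_iff, hKD]
  exact ENNReal.ofReal_pos.2 hD

/-- The spherical intersection property of complete sets. -/
theorem IsDiamComplete.mem_of_forall_dist_le (hK : IsDiamComplete K)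
    (hKD : Metric.ediam K = ENNReal.ofReal D) {y : HypSpace n}
    (hy : ∀ x ∈ K, dist x y ≤ D) : y ∈ K := by
  by_contra h
  refine (hK y h).not_ge ?_
  rw [hKD]
  have hle : ∀ x ∈ K, edist x y ≤ ENNReal.ofReal D := fun x hx => by
    rw [edist_dist]
    exact ENNReal.ofReal_le_ofReal (hy x hx)
  refine Metric.ediam_le ?_
  rintro a (ha | rfl) b (hb | rfl)
  · exact hKD ▸ Metric.edist_le_ediam_of_mem ha hb
  · exact hle a ha
  · exact edist_comm b a ▸ hle b hb
  · simp

theorem IsDiamComplete.isGeodConvex (hK : IsDiamComplete K)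
    (hKD : Metric.ediam K = ENNReal.ofReal D) (hD : 0 < D) : IsGeodConvex K := by
  intro x hx y hy z hz
  refine hK.mem_of_forall_dist_le hKD fun c hc => ?_
  rw [dist_comm]
  exact isGeodConvex_closedBall c hD.le x (dist_le_of_ediam hKD hD hx hc) y
    (dist_le_of_ediam hKD hD hy hc) hz

/-- The spherical intersection property makes the image closed; one point of `K` bounds the heights
of all others. The image is used because the maximization takes place in the ambient convex hull. -/
theorem IsDiamComplete.isCompact_image (hK : IsDiamComplete K)
    (hKD : Metric.ediam K = ENNReal.ofReal D) (hD : 0 < D) : IsCompact (HypSpace.pt '' K) := by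
  obtain ⟨x₀, hx₀⟩ := (nontrivial_of_ediam hKD hD).nonempty
  have himage : HypSpace.pt '' K = {q | 1 ≤ q.2} ∩ {q | lorentzForm q q = 1} ∩
      ⋂ x ∈ K, {q | lorentzForm x.pt q ≤ Real.cosh D} := by
    ext q
    simp only [Set.mem_image, Set.mem_inter_iff, Set.mem_ofPred_eq, Set.mem_iInter]
    constructor
    · rintro ⟨y, hy, rfl⟩
      exact ⟨⟨y.one_le, y.form_self⟩, fun x hx =>
        (dist_le_iff _ _ hD.le).1 (dist_le_of_ediam hKD hD hx hy)⟩
    · rintro ⟨⟨h1, h2⟩, h3⟩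
      exact ⟨⟨q, h1, h2⟩, hK.mem_of_forall_dist_le hKD fun x hx =>
        (dist_le_iff x ⟨q, h1, h2⟩ hD.le).2 (h3 x hx), rfl⟩
  have hclosed : IsClosed (HypSpace.pt '' K) := by
    rw [himage]
    refine IsClosed.inter (IsClosed.inter ?_ ?_) (isClosed_biInter fun x _ => ?_)
    · exact isClosed_le continuous_const continuous_snd
    · exact isClosed_eq (continuous_lorentzForm.comp (continuous_id.prodMk continuous_id))
        continuous_const
    · exact isClosed_le (continuous_lorentzForm.comp (continuous_const.prodMk continuous_id))
        continuous_const
  refine Metric.isCompact_of_isClosed_isBounded hclosed ?_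
  have h1 := normSq_eq x₀
  have h2 := x₀.one_le
  -- The point `x₀` is inside the open future cone, and `𝓑(x₀, y)` is at least this number times the
  -- height of `y`.
  have h3 : 0 < x₀.pt.2 - ‖x₀.pt.1‖ := by nlinarith [norm_nonneg x₀.pt.1]
  refine isBounded_iff_forall_norm_le.2 ⟨Real.cosh D / (x₀.pt.2 - ‖x₀.pt.1‖), ?_⟩
  rintro _ ⟨y, hy, rfl⟩
  have h4 := normSq_eq y
  have h5 := y.one_le
  have h6 : ‖y.pt.1‖ ≤ y.pt.2 := abs_le_of_sq_le_sq' (by linarith) (by linarith) |>.2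
  have h7 := (dist_le_iff _ _ hD.le).1 (dist_le_of_ediam hKD hD hx₀ hy)
  have h8 : y.pt.2 ≤ Real.cosh D / (x₀.pt.2 - ‖x₀.pt.1‖) := by
    rw [le_div_iff₀ h3]
    unfold lorentzForm at h7
    nlinarith [real_inner_le_norm x₀.pt.1 y.pt.1,
      mul_le_mul_of_nonneg_left h6 (norm_nonneg x₀.pt.1)]
  refine max_le (h6.trans h8) ?_
  rwa [Real.norm_of_nonneg (by linarith)]

/-- A ball inside a set of diameter `D` yields a concentric ball containing the set. -/
theorem dist_le_sub_of_closedBall_subset (hKD : Metric.ediam K = ENNReal.ofReal D) (hD : 0 < D)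
    {z : HypSpace n} {r : ℝ} (hr : 0 ≤ r) (hz : Metric.closedBall z r ⊆ K) {x : HypSpace n}
    (hx : x ∈ K) : dist x z ≤ D - r := by
  have key : ∀ x ∈ K, x ≠ z → dist x z ≤ D - r := fun x hx hxz => by
    obtain ⟨y, hy, hxy⟩ := exists_dist_eq_add hxz hr
    have := dist_le_of_ediam hKD hD hx (hz (Metric.mem_closedBall.2 hy.le))
    linarith
  -- No direction is singled out when `x = z`; `r ≤ D` then comes from another point of `K`.
  by_cases hxz : x = z
  · obtain ⟨x', hx', hne⟩ := (nontrivial_of_ediam hKD hD).exists_ne z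
    rw [hxz, dist_self]
    exact dist_nonneg.trans (key x' hx' hne)
  · exact key x hx hxz

/-- In a complete set of diameter `D`, inradius and circumradius add up to `D`. -/
theorem IsDiamComplete.isGreatest_innerRadii (hK : IsDiamComplete K)
    (hKD : Metric.ediam K = ENNReal.ofReal D) (hD : 0 < D) {R : ℝ}
    (hR : IsLeast (outerRadii K) R) : IsGreatest (innerRadii K) (D - R) := by
  obtain ⟨x₀, hx₀⟩ := (nontrivial_of_ediam hKD hD).nonempty
  constructor
  -- The ball of radius `D - R` about a circumcentre is within `D` of every point of `K`, hence in
  -- `K`.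
  · obtain ⟨-, z, hz⟩ := hR.1
    refine ⟨sub_nonneg.2 (hR.2 ⟨hD.le, x₀, fun x hx => dist_le_of_ediam hKD hD hx hx₀⟩), z,
      fun y hy => hK.mem_of_forall_dist_le hKD fun x hx => ?_⟩
    have h1 := Metric.mem_closedBall.1 (hz hx)
    have h2 := Metric.mem_closedBall'.1 hy
    linarith [dist_triangle x z y]
  · rintro r ⟨hr, z, hz⟩
    have h := fun x hx => dist_le_sub_of_closedBall_subset hKD hD hr hz (x := x) hx
    linarith [hR.2 ⟨dist_nonneg.trans (h x₀ hx₀), z, h⟩]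

end Complete

end HypSpace

/-! ### The theorem -/

theorem mainTheorem5 (n : ℕ) (hn : 2 ≤ n) (D : ℝ) (hD : 0 < D)
    (K : Set (HypSpace n)) (hK : HypSpace.IsDiamComplete K)
    (hKD : Metric.ediam K = ENNReal.ofReal D)
    (Δ : Set (HypSpace n)) (hΔ : HypSpace.IsRegularSimplex D Δ) :
    -- the minima and the maximum that define the radii are attained
    (IsLeast (HypSpace.outerRadii K) (HypSpace.circumradius K) ∧
      IsGreatest (HypSpace.innerRadii K) (HypSpace.inradius K) ∧
      IsLeast (HypSpace.outerRadii Δ) (HypSpace.circumradius Δ)) ∧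
    HypSpace.circumradius K ≤ HypSpace.circumradius Δ ∧
    HypSpace.inradius K ≥ D - HypSpace.circumradius Δ ∧
    (HypSpace.circumradius K = HypSpace.circumradius Δ ↔ HypSpace.ContainsCongruentCopy K Δ) ∧
    (HypSpace.inradius K = D - HypSpace.circumradius Δ ↔ HypSpace.ContainsCongruentCopy K Δ) := by
  obtain ⟨v, hv, rfl⟩ := hΔ
  have hΔ := HypSpace.isLeast_outerRadii_of_dist hv
  rw [← HypSpace.outerRadii_geodHull] at hΔ
  obtain ⟨q, hq1, hq, hqle, hqeq⟩ := HypSpace.exists_isLeast_outerRadii hD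
    (hK.isCompact_image hKD hD) (HypSpace.nontrivial_of_ediam hKD hD).nonempty
    fun x hx y hy => HypSpace.dist_le_of_ediam hKD hD hx hy
  have hin := hK.isGreatest_innerRadii hKD hD hq
  have eΔ : HypSpace.circumradius (HypSpace.geodHull (Set.range v)) = _ := hΔ.csInf_eq
  have eR : HypSpace.circumradius K = _ := hq.csInf_eq
  have er : HypSpace.inradius K = _ := hin.csSup_eq
  rw [eΔ, eR, er]
  set Q : ℝ := (1 + n * Real.cosh D) / (n + 1) with hQ
  have hq0 : 0 < √q := Real.sqrt_pos.2 (by linarith)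
  have hQ0 : 0 < √Q := Real.sqrt_pos.2 (by linarith)
  have hle : Real.arcosh (√q) ≤ Real.arcosh (√Q) :=
    (Real.arcosh_le_arcosh hq0 hQ0).2 (Real.sqrt_le_sqrt hqle)
  have hiff : Real.arcosh (√q) = Real.arcosh (√Q) ↔
      HypSpace.ContainsCongruentCopy K (HypSpace.geodHull (Set.range v)) := by
    constructor
    · intro h
      have h1 := (Real.arcosh_le_arcosh hQ0 hq0).1 h.ge
      rw [Real.sqrt_le_sqrt_iff (by linarith)] at h1
      obtain ⟨w, hwK, hw⟩ := hqeq (le_antisymm hqle h1)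
      exact HypSpace.containsCongruentCopy_of_dist hD hv hw (hK.isGeodConvex hKD hD) hwK
    -- A ball containing `K` contains the vertices of the copy, so its radius is at least the
    -- circumradius of the simplex.
    · rintro ⟨g, hg⟩
      refine le_antisymm hle ?_
      have hgv : ∀ i j, i ≠ j → dist (g (v i)) (g (v j)) = D := fun i j hij => by
        rw [g.isometry.dist_eq, hv i j hij]
      obtain ⟨hR, z, hz⟩ := hq.1
      refine (HypSpace.isLeast_outerRadii_of_dist hgv).2 ⟨hR, z, ?_⟩
      rintro _ ⟨i, rfl⟩
      exact hz (hg ⟨v i, HypSpace.subset_geodHull _ ⟨i, rfl⟩, rfl⟩)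
  refine ⟨⟨hq, hin, hΔ⟩, hle, by linarith, hiff, ?_⟩
  rw [← hiff]
  exact sub_right_inj
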